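/- **Definitions.** A *postselecting realtime probabilistic counter automaton* (PostPCA) over an alphabet $\Sigma$ has a finite set of states $S$, a starting state, two distinct states $s_{pa}, s_{pr}$ and one integer counter, which is initially $0$. It reads $\cent w \dollar$ from left to right, one symbol per step. In each step, depending on the current state, the symbol read and whether the counter is zero, it switches to state $s'$ and adds $d\in\{-1,0,1\}$ to the counter, with real-valued probabilities that sum to $1$ over $(s',d)$. Let $a(w)$ and $r(w)$ be the probabilities of being in $s_{pa}$ and in $s_{pr}$ after reading $\cent w\dollar$. The automaton *recognizes* $L\subseteq\Sigma^*$ *with error bound* $\epsilon$ if, for every $w\in\Sigma^*$, we have $a(w)+r(w)>0$, and $\frac{a(w)}{a(w)+r(w)}\ge 1-\epsilon$ if $w\in L$, and $\frac{r(w)}{a(w)+r(w)}\ge 1-\epsilon$ if $w\notin L$. It is *linear-space* if there is $f(n)=O(n)$ such that, on inputs of length $n$, the absolute value of the counter never exceeds $f(n)$ on any computation path of non-zero probability. For $k\ge 1$ let $$w_k = 0^{2^0}10^{2^1}10^{2^2}1\cdots 10^{2^{6k-2}}\,11\,0^{2^{6k-1}}\,1\,1^{2^{6k}}\,(0^{2^{3k}-1}1)^{2^{3k}},$$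 let $\mathtt{DIMA3}=\{w_k \mid k\ge 1\}$ (so $w_k$ is its $k$-th shortest member), and for a set $I$ of positive integers let $\mathtt{DIMA3}(I)=\{w_k\mid k\in I\}$. Let $p_I\in[0,1]$ be the number with binary expansion $p_I = 0.x_1 01\,x_2 01\,x_3 01\cdots$, where $x_i=1$ if $i\in I$ and $x_i=0$ otherwise. **Theorem.** Linear-space PostPCAs recognize uncountably many languages over $\{0,1\}$ with error bound $\frac25$. Moreover, for every set $I$ of positive integers there is a linear-space PostPCA, all of whose transition probabilities are rational or equal to $p_I$ or $1-p_I$ (so that, apart from rational probabilities, it only uses a coin with head probability $p_I$), that recognizes $\mathtt{DIMA3}(I)$ with error bound $\frac25$. -/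

import Mathlib

/-- The symbols that an automaton reads: the left end-marker, the input symbols and the right
end-marker. -/
inductive TapeSymbol (α : Type) : Type
  | cent : TapeSymbol α
  | sym (a : α) : TapeSymbol α
  | dollar : TapeSymbol α

/-- The input `w` between its two end-markers. -/
def markedInput {α : Type} (w : List α) : List (TapeSymbol α) :=
  TapeSymbol.cent :: (w.map TapeSymbol.sym ++ [TapeSymbol.dollar])

/-- A postselecting realtime probabilistic automaton with one integer counter, over the input
alphabet `α`. In state `s`, reading the symbol `σ`, with `z` telling whether the value of the
counter is zero, it switches to state `s'` and adds `d ∈ {-1, 0, 1}` to the counter with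
probability `δ s σ z s' d`. -/
structure PostPCA (α : Type) where
  /-- the states -/
  State : Type
  [fintypeState : Fintype State]
  [decEqState : DecidableEq State]
  /-- the transition probabilities -/
  δ : State → TapeSymbol α → Bool → State → SignType → ℝ
  /-- the starting state -/
  start : State
  /-- the postselecting accepting state -/
  accept : State
  /-- the postselecting rejecting state -/
  reject : State
  accept_ne_reject : accept ≠ reject
  δ_nonneg : ∀ s σ z s' d, 0 ≤ δ s σ z s' d
  δ_sum : ∀ s σ z, ∑ s', ∑ d, δ s σ z s' d = 1

namespace PostPCA

attribute [instance] PostPCA.fintypeState PostPCA.decEqState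

variable {α : Type}

/-- `P.endProb q u s c` is the probability that `P`, started in state `s` with value `c` of the
counter, is in state `q` after reading the string `u`, one symbol in each step. -/
def endProb (P : PostPCA α) (q : P.State) : List (TapeSymbol α) → P.State → ℤ → ℝ
  | [], s, _ => if s = q then 1 else 0
  | σ :: u, s, c =>
      ∑ s', ∑ d : SignType, P.δ s σ (decide (c = 0)) s' d * endProb P q u s' (c + (d : ℤ))

/-- The probability `a(w)` of ending in the postselecting accepting state on input `w`. -/
def acceptWeight (P : PostPCA α) (w : List α) : ℝ :=
  P.endProb P.accept (markedInput w) P.start 0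

/-- The probability `r(w)` of ending in the postselecting rejecting state on input `w`. -/
def rejectWeight (P : PostPCA α) (w : List α) : ℝ :=
  P.endProb P.reject (markedInput w) P.start 0

/-- `P` recognizes `L` with error bound `ε`: postselection is possible on every input, and, after
normalization, members are accepted and non-members are rejected with probability at least
`1 - ε`. -/
def Recognizes (P : PostPCA α) (L : Language α) (ε : ℝ) : Prop :=
  ∀ w : List α,
    0 < P.acceptWeight w + P.rejectWeight w ∧
    (w ∈ L → 1 - ε ≤ P.acceptWeight w / (P.acceptWeight w + P.rejectWeight w)) ∧
    (w ∉ L → 1 - ε ≤ P.rejectWeight w / (P.acceptWeight w + P.rejectWeight w))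

/-- `P.Reaches u s c`: with non-zero probability, `P` is in state `s` with value `c` of the counter
after reading the string `u` from its initial configuration. -/
inductive Reaches (P : PostPCA α) : List (TapeSymbol α) → P.State → ℤ → Prop
  | init : Reaches P [] P.start 0
  | step {u : List (TapeSymbol α)} {s : P.State} {c : ℤ} (σ : TapeSymbol α) (s' : P.State)
      (d : SignType) : Reaches P u s c → P.δ s σ (decide (c = 0)) s' d ≠ 0 →
        Reaches P (u ++ [σ]) s' (c + (d : ℤ))

/-- On every input of length `n`, the absolute value of the counter is never more than `f n`, on
any computation path of non-zero probability. -/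
def RunsInSpace (P : PostPCA α) (f : ℕ → ℕ) : Prop :=
  ∀ (w : List α) (u : List (TapeSymbol α)) (s : P.State) (c : ℤ),
    u <+: markedInput w → P.Reaches u s c → |c| ≤ (f w.length : ℤ)

/-- Space `O(n)`. -/
def IsLinearSpace (P : PostPCA α) : Prop :=
  ∃ f : ℕ → ℕ,
    Asymptotics.IsBigO Filter.atTop (fun n => (f n : ℝ)) (fun n : ℕ => (n : ℝ)) ∧ P.RunsInSpace f

end PostPCA

/-- The word
`0^(2^0) 1 0^(2^1) 1 ⋯ 1 0^(2^(6k-2)) 11 0^(2^(6k-1)) 1 1^(2^(6k)) (0^(2^(3k)-1) 1)^(2^(3k))`,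
used for `k > 0`. -/
def dima3Word (k : ℕ) : List (Fin 2) :=
  (List.range (6 * k - 1)).flatMap (fun i => List.replicate (2 ^ i) 0 ++ [1]) ++
    [1] ++ List.replicate (2 ^ (6 * k - 1)) 0 ++ [1] ++ List.replicate (2 ^ (6 * k)) 1 ++
    (List.replicate (2 ^ (3 * k)) (List.replicate (2 ^ (3 * k) - 1) 0 ++ [1])).flatten

/-- The language of all `dima3Word k` with `k > 0`. -/
def DIMA3 : Language (Fin 2) := {w | ∃ k : ℕ, 0 < k ∧ w = dima3Word k}

/-- The lengths increase strictly, so `dima3Word k` is the `k`-th shortest member of `DIMA3`. -/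
theorem dima3Word_length_lt {k l : ℕ} (h : k < l) :
    (dima3Word k).length < (dima3Word l).length := by
  have key : ∀ k, (dima3Word k).length =
      (∑ i ∈ Finset.range (6 * k - 1), (2 ^ i + 1)) + 2 ^ (6 * k - 1) + 2 ^ (6 * k) +
        2 ^ (3 * k) * (2 ^ (3 * k) - 1 + 1) + 2 := by
    intro k
    simp [dima3Word, List.length_flatMap, Finset.sum, Multiset.range]
    ring
  rw [key, key]
  have h1 : ∑ i ∈ Finset.range (6 * k - 1), (2 ^ i + 1) ≤
      ∑ i ∈ Finset.range (6 * l - 1), (2 ^ i + 1) :=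
    Finset.sum_le_sum_of_subset (Finset.range_mono (by omega))
  have h2 : 2 ^ (6 * k - 1) ≤ 2 ^ (6 * l - 1) := Nat.pow_le_pow_right (by norm_num) (by omega)
  have h3 : 2 ^ (6 * k) < 2 ^ (6 * l) := Nat.pow_lt_pow_right (by norm_num) (by omega)
  have h4 : 2 ^ (3 * k) ≤ 2 ^ (3 * l) := Nat.pow_le_pow_right (by norm_num) (by omega)
  have h5 : 2 ^ (3 * k) * (2 ^ (3 * k) - 1 + 1) ≤ 2 ^ (3 * l) * (2 ^ (3 * l) - 1 + 1) :=
    Nat.mul_le_mul h4 (by omega)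
  omega

/-- The language `DIMA3(I)` of the `k`-th shortest members of `DIMA3` with `k ∈ I`. -/
def DIMA3On (I : Set ℕ+) : Language (Fin 2) :=
  {w | w ∈ DIMA3 ∧ ∃ k ∈ I, w = dima3Word (k : ℕ)}

open Classical in
/-- The binary digits `x₁ 0 1 x₂ 0 1 x₃ 0 1 ⋯`, where `xᵢ = 1` if and only if `i ∈ I`; the first
digit has index `0`. -/
noncomputable def coinDigit (I : Set ℕ+) (n : ℕ) : Fin 2 :=
  if n % 3 = 0 then (if Nat.succPNat (n / 3) ∈ I then 1 else 0)
  else if n % 3 = 1 then 0 else 1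

/-- The probability `p_I = 0.x₁01x₂01x₃01⋯` (in binary) of a head of the coin of `I`. -/
noncomputable def coinProb (I : Set ℕ+) : ℝ := Real.ofDigits (coinDigit I)

/-! Distinct sets `I` give distinct languages `DIMA3On I`, so Cantor's theorem reduces
uncountability to building one automaton for each `I`. Space is automatic: the counter moves by at
most one per symbol.

At the left end-marker the automaton enters each of eight deterministic checks with probability 2/17
and a coin branch with probability 1/17. A check rejects if it finds an error and otherwise ends in
a neutral state, which postselection discards. The checks all pass exactly on `DIMA3`
(`Control.forall_passes_iff`): one is a finite-state test of the shape, the other seven use the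
counter to compare lengths. Outside `DIMA3`, rejection has weight at least 2/17 and acceptance at
most 1/17, so the error is at most 1/3.

On the `k`-th member only the coin branch survives. It tosses the coin once for each of the 64ᵏ ones
and counts the heads `C`. The standard deviation of `C` is at most 8ᵏ/2, so by Chebyshev `C` is
within 8ᵏ of 64ᵏp with probability at least 3/4 (`tossMean_coinProb_ge`). The integer part of 8ᵏp
ends in the bits `xₖ01`; this padding makes the bit `xₖ` survive an error of one unit in `C / 8ᵏ`.
The tail, 8ᵏ blocks of length 8ᵏ, lets the automaton compute `C / 8ᵏ` modulo 8 by emptying the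
counter and counting blocks (`Control.prob_coinTail`). -/

/-! ### Words as sequences of blocks -/

/-- The block `0ⁿ1`. -/
def zeroBlock (n : ℕ) : List (Fin 2) := List.replicate n 0 ++ [1]

/-- The concatenation of the blocks `0ⁿ1` for the entries `n` of a list. -/
def zeroBlocks (l : List ℕ) : List (Fin 2) := l.flatMap zeroBlock

@[simp] theorem zeroBlocks_nil : zeroBlocks [] = [] := rfl

@[simp] theorem zeroBlocks_cons (n : ℕ) (l : List ℕ) :
    zeroBlocks (n :: l) = List.replicate n 0 ++ 1 :: zeroBlocks l := by
  simp [zeroBlocks, zeroBlock]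

/-- The words of the general shape of a member of `DIMA3`. -/
def shapedWord (A : List ℕ) (n b : ℕ) (D : List ℕ) : List (Fin 2) :=
  zeroBlocks A ++ 1 :: (List.replicate n 0 ++ 1 :: (List.replicate b 1 ++ zeroBlocks D))

theorem dima3Word_eq_shapedWord (k : ℕ) :
    dima3Word k = shapedWord ((List.range (6 * k - 1)).map (2 ^ ·)) (2 ^ (6 * k - 1)) (2 ^ (6 * k))
      (List.replicate (2 ^ (3 * k)) (2 ^ (3 * k) - 1)) := by
  simp only [dima3Word, shapedWord, zeroBlocks, List.flatMap_map, List.append_assoc,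
    List.singleton_append, List.flatMap_replicate]
  rfl

/-! ### The languages `DIMA3(I)` -/

theorem dima3Word_injective : Function.Injective dima3Word := by
  intro k l h
  have h' := congrArg List.length h
  rcases lt_trichotomy k l with hk | hk | hk
  · exact absurd h' (dima3Word_length_lt hk).ne
  · exact hk
  · exact absurd h' (dima3Word_length_lt hk).ne'

theorem dima3Word_mem_dima3On (I : Set ℕ+) (k : ℕ+) : dima3Word k ∈ DIMA3On I ↔ k ∈ I := by
  constructor
  · rintro ⟨-, j, hj, h⟩
    rwa [PNat.coe_injective (dima3Word_injective h)]
  · exact fun h => ⟨⟨k, k.pos, rfl⟩, k, h, rfl⟩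

theorem DIMA3On_injective : Function.Injective DIMA3On := by
  intro I J h
  ext k
  rw [← dima3Word_mem_dima3On, h, dima3Word_mem_dima3On]

theorem not_countable_of_range_DIMA3On_subset {S : Set (Language (Fin 2))}
    (h : ∀ I, DIMA3On I ∈ S) : ¬ S.Countable := by
  intro hS
  have : Countable (Set ℕ+) :=
    Set.countable_univ_iff.1 ((hS.preimage DIMA3On_injective).mono fun I _ => h I)
  obtain ⟨f, hf⟩ := exists_injective_nat (Set ℕ+)
  exact Function.cantor_injective (fun s => Nat.succPNat (f s))
    (Nat.succPNat_injective.comp hf)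

/-! ### Space -/

theorem PostPCA.Reaches.abs_le {α : Type} {P : PostPCA α} {u : List (TapeSymbol α)} {s : P.State}
    {c : ℤ} (h : P.Reaches u s c) : |c| ≤ u.length := by
  induction h with
  | init => simp
  | step σ s' d _ _ ih =>
    have hd : |(d : ℤ)| ≤ 1 := by cases d <;> simp
    have := abs_add_le (α := ℤ) ‹ℤ› d
    push_cast [List.length_append, List.length_singleton]
    linarith

/-- The counter of a realtime automaton grows at most linearly. -/
theorem PostPCA.isLinearSpace {α : Type} (P : PostPCA α) : P.IsLinearSpace := by
  -- The 2 accounts for the end-markers.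
  refine ⟨fun n => n + 2, ?_, fun w u s c hu h => h.abs_le.trans ?_⟩
  · refine Asymptotics.IsBigO.of_bound 3 ?_
    filter_upwards [Filter.eventually_ge_atTop 1] with n hn
    have : (1 : ℝ) ≤ n := by exact_mod_cast hn
    rw [Real.norm_of_nonneg (by positivity), Real.norm_of_nonneg (by positivity)]
    push_cast
    linarith
  · have := hu.length_le
    simp only [markedInput, List.length_cons, List.length_append, List.length_map,
      List.length_nil] at this
    exact_mod_cast this

/-! ### The coin -/

theorem exists_nat_eq_two_pow_mul_sum_ofDigitsTerm (a : ℕ → Fin 2) (n : ℕ) :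
    ∃ m : ℕ, (2 : ℝ) ^ n * ∑ i ∈ Finset.range n, Real.ofDigitsTerm a i = m := by
  induction n with
  | zero => exact ⟨0, by simp⟩
  | succ n ih =>
    obtain ⟨m, hm⟩ := ih
    refine ⟨2 * m + (a n : ℕ), ?_⟩
    rw [Finset.sum_range_succ, mul_add, pow_succ', mul_assoc, hm, Real.ofDigitsTerm]
    push_cast
    field_simp
    ring

open Classical in
-- Multiplying by 8ᵏ moves the first `k` triples of bits in front of the binary point; the last of
-- them is 101 or 001. The remaining digits form a number in [0, 1].
theorem exists_coinProb_approx (I : Set ℕ+) (k : ℕ+) :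
    ∃ m : ℕ, (m : ℝ) ≤ 8 ^ (k : ℕ) * coinProb I ∧ 8 ^ (k : ℕ) * coinProb I ≤ m + 1 ∧
      m % 8 = if k ∈ I then 5 else 1 := by
  obtain ⟨l, rfl⟩ : ∃ l, k = Nat.succPNat l := ⟨k.natPred, by simp⟩
  obtain ⟨m, hm⟩ := exists_nat_eq_two_pow_mul_sum_ofDigitsTerm (coinDigit I) (3 * l)
  have hx := Real.ofDigits_eq_sum_add_ofDigits (coinDigit I) (3 * l + 3)
  set y := Real.ofDigits fun i => coinDigit I (i + (3 * l + 3))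
  have hy0 : 0 ≤ y := Real.ofDigits_nonneg _
  have hy1 : y ≤ 1 := Real.ofDigits_le_one _
  have d0 : coinDigit I (3 * l) = if Nat.succPNat l ∈ I then 1 else 0 := by
    simp [coinDigit]
  have d1 : coinDigit I (3 * l + 1) = 0 := by
    simp [coinDigit, show (3 * l + 1) % 3 = 1 by omega]
  have d2 : coinDigit I (3 * l + 2) = 1 := by
    simp [coinDigit, show (3 * l + 2) % 3 = 2 by omega]
  have h8 : (8 : ℝ) ^ (l + 1) = 2 ^ (3 * l) * 8 := by
    rw [pow_succ, pow_mul]; norm_num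
  have key : (8 : ℝ) ^ (l + 1) * coinProb I =
      ((8 * m + (if Nat.succPNat l ∈ I then 5 else 1) : ℕ) : ℝ) + y := by
    rw [coinProb, hx, Finset.sum_range_succ, Finset.sum_range_succ, Finset.sum_range_succ, h8]
    generalize ∑ i ∈ Finset.range (3 * l), Real.ofDigitsTerm (coinDigit I) i = S at hm
    simp only [Real.ofDigitsTerm, d0, d1, d2]
    have h2 : (2 : ℝ) ^ (3 * l) ≠ 0 := by positivity
    push_cast
    rw [← hm]
    simp only [pow_add]
    split_ifs <;> field_simp <;> norm_num <;> ring
  refine ⟨8 * m + (if Nat.succPNat l ∈ I then 5 else 1), ?_, ?_, ?_⟩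
  · rw [Nat.succPNat_coe, Nat.succ_eq_add_one, key]; linarith
  · rw [Nat.succPNat_coe, Nat.succ_eq_add_one, key]; linarith
  · split_ifs <;> omega

/-- The expected value of `F` at the number of heads in `n` tosses of a coin with head probability
`p`, plus `c`. -/
def tossMean (p : ℝ) (F : ℕ → ℝ) : ℕ → ℕ → ℝ
  | 0, c => F c
  | n + 1, c => p * tossMean p F n (c + 1) + (1 - p) * tossMean p F n c

/-- Chebyshev's inequality for the number of heads. -/
theorem tossMean_ge {p : ℝ} (hp0 : 0 ≤ p) (hp1 : p ≤ 1) {F : ℕ → ℝ} {μ N : ℝ} {M : ℕ}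
    (hF : ∀ c ≤ M, 1 - ((c : ℝ) - μ) ^ 2 / N ≤ F c) (n c : ℕ) (h : c + n ≤ M) :
    1 - ((c + n * p - μ) ^ 2 + n * (p * (1 - p))) / N ≤ tossMean p F n c := by
  induction n generalizing c with
  | zero => simpa [tossMean] using hF c (by omega)
  | succ n ih =>
    have h1 := mul_le_mul_of_nonneg_left (ih (c + 1) (by omega)) hp0
    have h2 := mul_le_mul_of_nonneg_left (ih c (by omega)) (sub_nonneg.2 hp1)
    -- The second moment about `μ` is squared bias plus variance, and conditioning on one toss
    -- reproduces it exactly.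
    refine le_trans (le_of_eq ?_) (add_le_add h1 h2)
    push_cast
    ring

open Classical in
/-- After `64ᵏ` tosses of the coin of `I`, the third bit of the number of heads divided by `8ᵏ`
tells with probability at least `3/4` whether `k ∈ I`. -/
theorem tossMean_coinProb_ge (I : Set ℕ+) (k : ℕ+) (v : Bool) (hv : v = decide (k ∈ I)) :
    3 / 4 ≤ tossMean (coinProb I)
      (fun c => if decide (4 ≤ c / 8 ^ (k : ℕ) % 8) = v then 1 else 0) (64 ^ (k : ℕ)) 0 := by
  set p := coinProb I
  have hp0 : 0 ≤ p := Real.ofDigits_nonneg _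
  have hp1 : p ≤ 1 := Real.ofDigits_le_one _
  obtain ⟨m, hm0, hm1, hm⟩ := exists_coinProb_approx I k
  set c8 : ℕ := 8 ^ (k : ℕ) with hc8
  have hpos : 0 < c8 := by positivity
  have hposR : (0 : ℝ) < c8 := by exact_mod_cast hpos
  have h64 : (64 : ℕ) ^ (k : ℕ) = c8 * c8 := by rw [hc8, ← mul_pow]; norm_num
  have hm0 : (m : ℝ) ≤ c8 * p := by rw [hc8]; exact_mod_cast hm0
  have hm1 : c8 * p ≤ (m : ℝ) + 1 := by rw [hc8]; exact_mod_cast hm1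
  have hm2 := hm
  rw [h64]
  refine le_trans ?_ (tossMean_ge hp0 hp1 (μ := c8 * c8 * p) (N := c8 * c8) (M := c8 * c8)
    (fun c _ => ?_) (c8 * c8) 0 (by omega))
  · push_cast
    have : ((0 : ℝ) + c8 * c8 * p - c8 * c8 * p) ^ 2 + c8 * c8 * (p * (1 - p)) =
      (p * (1 - p)) * (c8 * c8) := by ring
    rw [this, mul_div_assoc, div_self (by positivity)]
    nlinarith [sq_nonneg (p - 1 / 2)]
  -- Far from the mean the quadratic lower bound is at most 0; near it the indicator has to be 1.
  · by_cases hc : |(c : ℝ) - c8 * c8 * p| < c8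
    · rw [if_pos]
      · have : 0 ≤ ((c : ℝ) - c8 * c8 * p) ^ 2 / (c8 * c8) := by positivity
        linarith
      · rw [abs_lt] at hc
        -- With `e2`, the quotient is `m - 1`, `m` or `m + 1`: modulo 8 it is 4, 5, 6 or 0, 1, 2.
        have e1 : m ≤ c / c8 + 1 := by
          have : m * c8 ≤ c + c8 := by
            have : (m : ℝ) * c8 ≤ c + c8 := by nlinarith
            exact_mod_cast this
          calc m = m * c8 / c8 := (Nat.mul_div_cancel _ hpos).symm
            _ ≤ (c + c8) / c8 := Nat.div_le_div_right this
            _ = c / c8 + 1 := Nat.add_div_right _ hpos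
        have e2 : c / c8 < m + 2 := by
          rw [Nat.div_lt_iff_lt_mul hpos]
          have : (c : ℝ) < (m + 2) * c8 := by nlinarith
          exact_mod_cast this
        rw [hv]
        split_ifs at hm with hk
        · simp only [hk, decide_true, decide_eq_true_eq]; omega
        · simp only [hk, decide_false, decide_eq_false_iff_not]; omega
    · have h1 : 1 ≤ ((c : ℝ) - c8 * c8 * p) ^ 2 / (c8 * c8) := by
        rw [one_le_div (by positivity), ← sq_abs]
        nlinarith [not_lt.1 hc]
      have h2 : (0 : ℝ) ≤ if decide (4 ≤ c / c8 % 8) = v then 1 else 0 := by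
        split_ifs <;> norm_num
      linarith

/-! ### The control -/

/-- The five checks that ignore the part of the word up to the marker `11`. -/
inductive LateCheck : Type
  | half
  | total
  | count
  | equal (skip : Bool)
  deriving DecidableEq, Fintype

/-- The states of the finite control. The states `shape…` check the general shape of the word, the
states `skip…`, `up…`, `down…` check that blocks with successive indices double, the states
`late…`, `tail…` run the late checks, and the states `coin…` use the coin. -/
inductive Control : Type
  | fail
  | pass
  | shapeStart
  | shapeFirst
  | shapeGap (i : Fin 6)
  | shapeRun (i : Fin 6)
  | shapeMark
  | shapeLong
  | shapeOnes
  | shapeTailRun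
  | shapeTailGap
  | skipGap (m : Bool)
  | skipRun (m : Bool)
  | upGap (m : Bool)
  | upRun (m : Bool)
  | downGap (m : Bool)
  | downOdd (m : Bool)
  | downEven (m : Bool)
  | lateGap (t : LateCheck)
  | lateRun (t : LateCheck)
  | lateLong (t : LateCheck)
  | lateOnes (t : LateCheck)
  | lateOnesOdd
  | tailTotal
  | tailFirst
  | tailCount
  | tailSkip
  | tailUp
  | tailDown
  | coinGap
  | coinRun
  | coinLong
  | coinToss
  | coinTail (j : Fin 8)
  | coinDone (v : Bool)
  deriving DecidableEq, Fintype

namespace Control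

/-- The next state and the change of the counter, when `a` is read, `z` tells whether the counter
is zero, and `h` is the outcome of a toss of the coin. -/
def step (s : Control) (a : Fin 2) (z h : Bool) : Control × SignType :=
  match s with
  | fail => (fail, 0)
  | pass => (pass, 0)
  | shapeStart => if a = 0 then (shapeFirst, 0) else (fail, 0)
  | shapeFirst => if a = 0 then (fail, 0) else (shapeGap 1, 0)
  -- The index counts completed blocks modulo 6; the marker must follow `6k - 1` of them.
  | shapeGap i => if a = 0 then (shapeRun i, 0) else if i = 5 then (shapeMark, 0) else (fail, 0)
  | shapeRun i => if a = 0 then (shapeRun i, 0) else (shapeGap (i + 1), 0)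
  | shapeMark => if a = 0 then (shapeLong, 0) else (fail, 0)
  | shapeLong => if a = 0 then (shapeLong, 0) else (shapeOnes, 0)
  | shapeOnes => if a = 0 then (shapeTailRun, 0) else (shapeOnes, 0)
  | shapeTailRun => if a = 0 then (shapeTailRun, 0) else (shapeTailGap, 0)
  | shapeTailGap => if a = 0 then (shapeTailRun, 0) else (fail, 0)
  -- The flag `m` records that the marker has been seen, so that the next completed block is the
  -- last one to compare.
  | skipGap m => if a = 0 then (skipRun m, 0) else (skipGap true, 0)
  | skipRun m => if a = 0 then (skipRun m, 0) else if m then (pass, 0) else (upGap false, 0)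
  | upGap m => if a = 0 then (upRun m, 1) else (upGap true, 0)
  | upRun m => if a = 0 then (upRun m, 1) else if m then (pass, 0) else (downGap false, 0)
  -- The counter drops on every second zero, so it returns to zero exactly when this block is twice
  -- the previous one.
  | downGap m => if a = 0 then (downOdd m, 0) else (downGap true, 0)
  | downOdd m => if a = 0 then (downEven m, -1) else (fail, 0)
  | downEven m => if a = 0 then (downOdd m, 0) else
      if z then (if m then (pass, 0) else (upGap false, 0)) else (fail, 0)
  | lateGap t => if a = 0 then (lateRun t, 0) else (lateLong t, 0)
  | lateRun t => if a = 0 then (lateRun t, 0) else (lateGap t, 0)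
  | lateLong t => if a = 0 then (lateLong t, if t = .half then 1 else 0) else (lateOnes t, 0)
  | lateOnes .half => if a = 0 then (if z then (pass, 0) else (fail, 0)) else (lateOnesOdd, 0)
  | lateOnes .total => if a = 0 then (tailTotal, -1) else (lateOnes .total, 1)
  | lateOnes .count => if a = 0 then (tailFirst, 1) else (lateOnes .count, 0)
  | lateOnes (.equal true) => if a = 0 then (tailSkip, 0) else (lateOnes (.equal true), 0)
  | lateOnes (.equal false) => if a = 0 then (tailUp, 1) else (lateOnes (.equal false), 0)
  | lateOnesOdd => if a = 0 then (fail, 0) else (lateOnes .half, -1)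
  | tailTotal => (tailTotal, -1)
  | tailFirst => if a = 0 then (tailFirst, 1) else (tailCount, 0)
  | tailCount => if a = 0 then (tailCount, 0) else (tailCount, -1)
  | tailSkip => if a = 0 then (tailSkip, 0) else (tailUp, 0)
  | tailUp => if a = 0 then (tailUp, 1) else (tailDown, 0)
  | tailDown => if a = 0 then (tailDown, -1) else if z then (tailUp, 0) else (fail, 0)
  | coinGap => if a = 0 then (coinRun, 0) else (coinLong, 0)
  | coinRun => if a = 0 then (coinRun, 0) else (coinGap, 0)
  | coinLong => if a = 0 then (coinLong, 0) else (coinToss, 0)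
  | coinToss => if a = 0 then (if z then (coinDone false, 0) else (coinTail 0, -1))
      else (coinToss, if h then 1 else 0)
  | coinTail j => if z then (coinDone (4 ≤ j), 0) else (coinTail (if a = 0 then j else j + 1), -1)
  | coinDone v => (coinDone v, 0)

/-- The verdict at the right end-marker: acceptance, rejection, or neither of them. -/
def verdict (s : Control) (z : Bool) : Option Bool :=
  match s with
  | pass | shapeTailGap | tailSkip | tailUp | tailDown => none
  | tailTotal | tailCount => if z then none else some false
  -- If all tosses on a member are heads, zero is reached only here. A leftover count cannot occur
  -- on members; its verdict only has to differ from `none`.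
  | coinTail j => if z then some (decide (4 ≤ j)) else some false
  | coinDone v => some v
  | _ => some false

/-- The probability of the verdict `v` when `u` is read from the state `s` with the counter at `c`,
where `p` is the head probability of the coin. -/
def prob (p : ℝ) (v : Option Bool) : List (Fin 2) → Control → ℤ → ℝ
  | [], s, c => if s.verdict (decide (c = 0)) = v then 1 else 0
  | a :: u, s, c =>
      p * prob p v u (s.step a (decide (c = 0)) true).1
          (c + ((s.step a (decide (c = 0)) true).2 : ℤ)) +
        (1 - p) * prob p v u (s.step a (decide (c = 0)) false).1
          (c + ((s.step a (decide (c = 0)) false).2 : ℤ))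

/-- The states that use the coin. -/
def IsCoin : Control → Prop
  | coinGap | coinRun | coinLong | coinToss | coinTail _ | coinDone _ => True
  | _ => False

/-- The check that starts in the state `s` with the counter at `c` finds no error in `u`. -/
def Passes : Control → ℤ → List (Fin 2) → Prop
  | s, c, [] => s.verdict (decide (c = 0)) = none
  -- The outcome `false` is a convention: the checks ignore the coin (`step_not_isCoin`).
  | s, c, a :: u => Passes (s.step a (decide (c = 0)) false).1
      (c + ((s.step a (decide (c = 0)) false).2 : ℤ)) u

/-! ### Checks never accept, and the coin branch never abstains -/

theorem step_not_isCoin {s : Control} (hs : ¬ s.IsCoin) (a : Fin 2) (z : Bool) :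
    s.step a z true = s.step a z false ∧ ¬ (s.step a z false).1.IsCoin := by
  cases s <;> first
    | exact absurd trivial hs
    | (rename_i t; rcases t with _ | _ | _ | _ | _ <;>
        (simp only [step]; (try split_ifs) <;> simp [IsCoin]))
    | (simp only [step]; (try split_ifs) <;> simp [IsCoin])

theorem verdict_not_isCoin {s : Control} (hs : ¬ s.IsCoin) (z : Bool) :
    s.verdict z ≠ some true := by
  cases s <;> first
    | exact absurd trivial hs
    | (simp only [verdict]; split_ifs <;> simp)
    | simp [verdict]

theorem prob_true_of_not_isCoin (p : ℝ) (u : List (Fin 2)) {s : Control} (hs : ¬ s.IsCoin)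
    (c : ℤ) : prob p (some true) u s c = 0 := by
  induction u generalizing s c with
  | nil => exact if_neg (verdict_not_isCoin hs _)
  | cons a u ih =>
    obtain ⟨h1, h2⟩ := step_not_isCoin hs a (decide (c = 0))
    simp only [prob, h1, ih h2, mul_zero, add_zero]

theorem prob_false_of_passes (p : ℝ) (u : List (Fin 2)) {s : Control} (hs : ¬ s.IsCoin) (c : ℤ)
    (h : Passes s c u) : prob p (some false) u s c = 0 := by
  induction u generalizing s c with
  | nil =>
    have h : s.verdict (decide (c = 0)) = none := h
    simp [prob, h]
  | cons a u ih =>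
    obtain ⟨h1, h2⟩ := step_not_isCoin hs a (decide (c = 0))
    simp only [prob, h1, ih h2 _ h, mul_zero, add_zero]

theorem prob_false_of_not_passes (p : ℝ) (u : List (Fin 2)) {s : Control} (hs : ¬ s.IsCoin) (c : ℤ)
    (h : ¬ Passes s c u) : prob p (some false) u s c = 1 := by
  induction u generalizing s c with
  | nil =>
    have h : s.verdict (decide (c = 0)) ≠ none := h
    refine if_pos ?_
    rcases hv : s.verdict (decide (c = 0)) with _ | _ | _
    · exact absurd hv h
    · rfl
    · exact absurd hv (verdict_not_isCoin hs _)
  | cons a u ih =>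
    obtain ⟨h1, h2⟩ := step_not_isCoin hs a (decide (c = 0))
    simp only [prob, h1, ih h2 _ h]
    ring

theorem prob_nonneg {p : ℝ} (hp0 : 0 ≤ p) (hp1 : p ≤ 1) (v : Option Bool) (u : List (Fin 2))
    (s : Control) (c : ℤ) : 0 ≤ prob p v u s c := by
  induction u generalizing s c with
  | nil => simp only [prob]; split_ifs <;> norm_num
  | cons a u ih =>
    exact add_nonneg (mul_nonneg hp0 (ih _ _)) (mul_nonneg (sub_nonneg.2 hp1) (ih _ _))

theorem step_isCoin {s : Control} (hs : s.IsCoin) (a : Fin 2) (z h : Bool) :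
    (s.step a z h).1.IsCoin := by
  cases s <;> first
    | exact absurd hs id
    | (simp only [step]; (try split_ifs) <;> simp [IsCoin])

theorem verdict_isCoin {s : Control} (hs : s.IsCoin) (z : Bool) :
    s.verdict z ≠ none := by
  cases s <;> first
    | exact absurd hs id
    | (simp only [verdict]; split_ifs <;> simp)
    | simp [verdict]

/-- Coin states lead only to coin states, whose verdict is never `none`. Hence postselection is
possible on every input. -/
theorem prob_add_prob_of_isCoin (p : ℝ) (u : List (Fin 2)) {s : Control} (hs : s.IsCoin) (c : ℤ) :
    prob p (some true) u s c + prob p (some false) u s c = 1 := by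
  induction u generalizing s c with
  | nil =>
    have h := verdict_isCoin hs (decide (c = 0))
    simp only [prob]
    rcases hv : s.verdict (decide (c = 0)) with _ | _ | _ <;> simp_all
  | cons a u ih =>
    have h1 := ih (step_isCoin hs a (decide (c = 0)) true)
      (c + ((s.step a (decide (c = 0)) true).2 : ℤ))
    have h2 := ih (step_isCoin hs a (decide (c = 0)) false)
      (c + ((s.step a (decide (c = 0)) false).2 : ℤ))
    simp only [prob]
    linear_combination p * h1 + (1 - p) * h2

end Control

/-- The entries with indices `0` and `1`, those with indices `2` and `3`, and so on, are related
by `R`. -/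
def List.PairsRelated (R : ℕ → ℕ → Prop) : List ℕ → Prop
  | x :: y :: l => R x y ∧ l.PairsRelated R
  | _ => True

/-- One counter can compare disjoint pairs of neighbours only, so a chain condition is split between
two checks, offset by one block. Dropping the head swaps their roles. -/
theorem List.pairsRelated_and_tail {R : ℕ → ℕ → Prop} (l : List ℕ) :
    l.PairsRelated R ∧ l.tail.PairsRelated R ↔ l.IsChain R := by
  match l with
  | [] => simp [List.PairsRelated]
  | [x] => simp [List.PairsRelated]
  | x :: y :: l =>
    have ih := List.pairsRelated_and_tail (R := R) (y :: l)
    rw [List.isChain_cons_cons, ← ih]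
    simp only [List.PairsRelated, List.tail_cons]
    tauto

namespace Control

/-! ### Checks on runs of equal letters -/

theorem passes_cons (s : Control) (c : ℤ) (a : Fin 2) (u : List (Fin 2)) :
    Passes s c (a :: u) ↔ Passes (s.step a (decide (c = 0)) false).1
      (c + ((s.step a (decide (c = 0)) false).2 : ℤ)) u := Iff.rfl

theorem passes_cons_of_step {s s' : Control} {a : Fin 2} {d : SignType}
    (h : ∀ z, s.step a z false = (s', d)) (c : ℤ) (u : List (Fin 2)) :
    Passes s c (a :: u) ↔ Passes s' (c + d) u := by
  rw [passes_cons, h]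

theorem not_passes_fail (c : ℤ) (u : List (Fin 2)) : ¬ Passes fail c u := by
  induction u generalizing c with
  | nil => simp [Passes, verdict]
  | cons a u ih => exact ih _

theorem passes_pass (c : ℤ) (u : List (Fin 2)) : Passes pass c u := by
  induction u generalizing c with
  | nil => simp [Passes, verdict]
  | cons a u ih => exact ih _

theorem passes_replicate {s : Control} {a : Fin 2} {d : SignType}
    (h : ∀ z, s.step a z false = (s, d)) (n : ℕ) (c : ℤ) (u : List (Fin 2)) :
    Passes s c (List.replicate n a ++ u) ↔ Passes s (c + n * d) u := by
  induction n generalizing c with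
  | zero => simp
  | succ n ih =>
    rw [List.replicate_succ, List.cons_append, passes_cons_of_step h, ih]
    push_cast
    ring_nf

theorem passes_replicate_succ {s s' : Control} {a : Fin 2} {d : SignType}
    (h : ∀ z, s.step a z false = (s', d)) (h' : ∀ z, s'.step a z false = (s', d))
    {n : ℕ} (hn : 0 < n) (c : ℤ) (u : List (Fin 2)) :
    Passes s c (List.replicate n a ++ u) ↔ Passes s' (c + n * d) u := by
  obtain ⟨n, rfl⟩ := Nat.exists_eq_succ_of_ne_zero hn.ne'
  rw [List.replicate_succ, List.cons_append, passes_cons_of_step h, passes_replicate h']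
  push_cast
  ring_nf

/-! ### The check of the shape -/

/-- The two states call each other, hence the joint induction; in the second one a block may be
partly read, so its remaining zeros may be none. -/
theorem exists_of_passes_shapeTail (u : List (Fin 2)) (c : ℤ) :
    (Passes shapeTailGap c u → ∃ D : List ℕ, (∀ x ∈ D, 0 < x) ∧ u = zeroBlocks D) ∧
    (Passes shapeTailRun c u → ∃ (n : ℕ) (D : List ℕ), (∀ x ∈ D, 0 < x) ∧
      u = List.replicate n 0 ++ 1 :: zeroBlocks D) := by
  induction u generalizing c with
  | nil => exact ⟨fun _ => ⟨[], by simp⟩, fun h => by simp [Passes, verdict] at h⟩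
  | cons a u ih =>
    fin_cases a
    · constructor
      · intro h
        obtain ⟨n, D, hD, rfl⟩ := (ih _).2 h
        exact ⟨(n + 1) :: D, by simpa using hD, by simp [List.replicate_succ]⟩
      · intro h
        obtain ⟨n, D, hD, rfl⟩ := (ih _).2 h
        exact ⟨n + 1, D, hD, by simp [List.replicate_succ]⟩
    · constructor
      · intro h
        exact absurd h (not_passes_fail _ _)
      · intro h
        obtain ⟨D, hD, rfl⟩ := (ih _).1 h
        exact ⟨0, D, hD, rfl⟩

theorem exists_of_passes_shapeOnes (u : List (Fin 2)) (c : ℤ) (h : Passes shapeOnes c u) :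
    ∃ (b : ℕ) (D : List ℕ), (∀ x ∈ D, 0 < x) ∧ D ≠ [] ∧
      u = List.replicate b 1 ++ zeroBlocks D := by
  induction u generalizing c with
  | nil => simp [Passes, verdict] at h
  | cons a u ih =>
    fin_cases a
    · obtain ⟨n, D, hD, rfl⟩ := (exists_of_passes_shapeTail u _).2 h
      exact ⟨0, (n + 1) :: D, by simpa using hD, by simp, by simp [List.replicate_succ]⟩
    · obtain ⟨b, D, hD, hD', rfl⟩ := ih _ h
      exact ⟨b + 1, D, hD, hD', by simp [List.replicate_succ]⟩

theorem exists_of_passes_shapeLong (u : List (Fin 2)) (c : ℤ) (h : Passes shapeLong c u) :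
    ∃ (n b : ℕ) (D : List ℕ), (∀ x ∈ D, 0 < x) ∧ D ≠ [] ∧
      u = List.replicate n 0 ++ 1 :: (List.replicate b 1 ++ zeroBlocks D) := by
  induction u generalizing c with
  | nil => simp [Passes, verdict] at h
  | cons a u ih =>
    fin_cases a
    · obtain ⟨n, b, D, hD, hD', rfl⟩ := ih _ h
      exact ⟨n + 1, b, D, hD, hD', by simp [List.replicate_succ]⟩
    · obtain ⟨b, D, hD, hD', rfl⟩ := exists_of_passes_shapeOnes u _ h
      exact ⟨0, b, D, hD, hD', rfl⟩

theorem exists_of_passes_shapeMark (u : List (Fin 2)) (c : ℤ) (h : Passes shapeMark c u) :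
    ∃ (n b : ℕ) (D : List ℕ), 0 < n ∧ (∀ x ∈ D, 0 < x) ∧ D ≠ [] ∧
      u = List.replicate n 0 ++ 1 :: (List.replicate b 1 ++ zeroBlocks D) := by
  cases u with
  | nil => simp [Passes, verdict] at h
  | cons a u =>
    fin_cases a
    · obtain ⟨n, b, D, hD, hD', rfl⟩ := exists_of_passes_shapeLong u _ h
      exact ⟨n + 1, b, D, by omega, hD, hD', by simp [List.replicate_succ]⟩
    · exact absurd h (not_passes_fail _ _)

/-- The blocks of zeros in `shapedWord A n b D` are non-empty, and there is at least one in the tail. -/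
structure IsShape (A : List ℕ) (n : ℕ) (D : List ℕ) : Prop where
  pos_of_mem_left : ∀ x ∈ A, 0 < x
  pos : 0 < n
  pos_of_mem_right : ∀ x ∈ D, 0 < x
  ne_nil : D ≠ []

theorem exists_of_passes_shapeGap (u : List (Fin 2)) (c : ℤ) (i : Fin 6) :
    (Passes (shapeGap i) c u → ∃ (A : List ℕ) (n b : ℕ) (D : List ℕ), IsShape A n D ∧
      u = shapedWord A n b D) ∧
    (Passes (shapeRun i) c u → ∃ (m : ℕ) (A : List ℕ) (n b : ℕ) (D : List ℕ), IsShape A n D ∧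
      u = List.replicate m 0 ++ 1 :: shapedWord A n b D) := by
  induction u generalizing c i with
  | nil => constructor <;> intro h <;> simp [Passes, verdict] at h
  | cons a u ih =>
    fin_cases a
    · constructor
      · intro h
        obtain ⟨m, A, n, b, D, hs, rfl⟩ := (ih _ _).2 h
        exact ⟨(m + 1) :: A, n, b, D, ⟨by simpa using hs.1, hs.2, hs.3, hs.4⟩,
          by simp [shapedWord, List.replicate_succ]⟩
      · intro h
        obtain ⟨m, A, n, b, D, hs, rfl⟩ := (ih _ _).2 h
        exact ⟨m + 1, A, n, b, D, hs, by simp [List.replicate_succ]⟩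
    · constructor
      · intro h
        by_cases hi : i = 5
        · subst hi
          obtain ⟨n, b, D, hn, hD, hD', rfl⟩ := exists_of_passes_shapeMark u _ h
          exact ⟨[], n, b, D, ⟨by simp, hn, hD, hD'⟩, rfl⟩
        · rw [passes_cons] at h
          simp only [step, Fin.mk_one, one_ne_zero, if_false, hi] at h
          exact absurd h (not_passes_fail _ _)
      · intro h
        obtain ⟨A, n, b, D, hs, rfl⟩ := (ih _ _).1 h
        exact ⟨0, A, n, b, D, hs, rfl⟩

theorem passes_shapeGap_zeroBlocks {A : List ℕ} (hA : ∀ x ∈ A, 0 < x) (i : Fin 6) (c : ℤ)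
    (u : List (Fin 2)) :
    Passes (shapeGap i) c (zeroBlocks A ++ u) ↔ Passes (shapeGap (i + Fin.ofNat 6 A.length)) c u := by
  induction A generalizing i c with
  | nil => simp
  | cons x A ih =>
    rw [zeroBlocks_cons, List.append_assoc,
      passes_replicate_succ (s' := shapeRun i) (d := 0) (fun _ => rfl) (fun _ => rfl)
        (hA x (by simp)), List.cons_append,
      passes_cons_of_step (s' := shapeGap (i + 1)) (d := 0) (fun _ => rfl),
      ih (fun y hy => hA y (by simp [hy]))]
    have h : i + 1 + Fin.ofNat 6 A.length = i + Fin.ofNat 6 (A.length + 1) := by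
      simp only [Fin.ext_iff, Fin.val_add, Fin.val_ofNat, Fin.isValue]
      omega
    rw [h]
    simp only [SignType.coe_zero, mul_zero, add_zero, List.length_cons]

theorem passes_shapeTailGap {D : List ℕ} (hD : ∀ x ∈ D, 0 < x) (c : ℤ) :
    Passes shapeTailGap c (zeroBlocks D) := by
  induction D with
  | nil => simp [Passes, verdict]
  | cons x D ih =>
    rw [zeroBlocks_cons, passes_replicate_succ (s' := shapeTailRun) (d := 0) (fun _ => rfl)
      (fun _ => rfl) (hD x (by simp)), passes_cons_of_step (s' := shapeTailGap) (d := 0)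
      (fun _ => rfl)]
    simpa using ih (fun y hy => hD y (by simp [hy]))

/-- On a word already known to be shaped, only the block count modulo 6 can fail. -/
theorem passes_shapeGap {A : List ℕ} {n b : ℕ} {D : List ℕ} (hs : IsShape A n D) (i : Fin 6)
    (c : ℤ) : Passes (shapeGap i) c (shapedWord A n b D) ↔ i + Fin.ofNat 6 A.length = 5 := by
  rw [shapedWord, passes_shapeGap_zeroBlocks hs.1]
  by_cases h : i + Fin.ofNat 6 A.length = 5
  · rw [h, passes_cons_of_step (s' := shapeMark) (d := 0) (fun _ => rfl),
      passes_replicate_succ (s' := shapeLong) (d := 0) (fun _ => rfl) (fun _ => rfl) hs.2,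
      passes_cons_of_step (s' := shapeOnes) (d := 0) (fun _ => rfl),
      passes_replicate (d := 0) (fun _ => rfl)]
    simp only [iff_true]
    match D, hs.4, hs.3 with
    | x :: D, _, hD =>
      rw [zeroBlocks_cons, passes_replicate_succ (s' := shapeTailRun) (d := 0) (fun _ => rfl)
        (fun _ => rfl) (hD x (by simp)), passes_cons_of_step (s' := shapeTailGap) (d := 0)
        (fun _ => rfl)]
      exact passes_shapeTailGap (fun y hy => hD y (by simp [hy])) _
  · rw [passes_cons]
    simp only [step, one_ne_zero, if_false, h]
    simpa using not_passes_fail _ _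

/-- The first block `01` is consumed separately and counted by the index 1, so 4 modulo 6 further
blocks remain before the marker. -/
theorem passes_shapeStart_iff (u : List (Fin 2)) (c : ℤ) :
    Passes shapeStart c u ↔ ∃ (A : List ℕ) (n b : ℕ) (D : List ℕ), IsShape (1 :: A) n D ∧
      A.length % 6 = 4 ∧ u = shapedWord (1 :: A) n b D := by
  have key : ∀ m : ℕ, (1 : Fin 6) + Fin.ofNat 6 m = 5 ↔ m % 6 = 4 := by
    intro m
    simp only [Fin.ext_iff, Fin.val_add, Fin.val_ofNat, Fin.isValue]
    omega
  constructor
  · intro h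
    match u with
    | [] => simp [Passes, verdict] at h
    | 1 :: _ => exact absurd h (not_passes_fail _ _)
    | [0] => simp [Passes, verdict, step] at h
    | 0 :: 0 :: _ => exact absurd h (not_passes_fail _ _)
    | 0 :: 1 :: u =>
      have h : Passes (shapeGap 1) (c + 0 + 0) u := h
      obtain ⟨A, n, b, D, hs, rfl⟩ := (exists_of_passes_shapeGap u _ _).1 h
      rw [passes_shapeGap hs, key] at h
      exact ⟨A, n, b, D, ⟨by simpa using hs.1, hs.2, hs.3, hs.4⟩, h, by simp [shapedWord]⟩
  · rintro ⟨A, n, b, D, hs, hA, rfl⟩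
    have e : shapedWord (1 :: A) n b D = 0 :: 1 :: shapedWord A n b D := by simp [shapedWord]
    rw [e, passes_cons_of_step (s' := shapeFirst) (d := 0) (fun _ => rfl),
      passes_cons_of_step (s' := shapeGap 1) (d := 0) (fun _ => rfl),
      passes_shapeGap ⟨fun x hx => hs.1 x (by simp [hx]), hs.2, hs.3, hs.4⟩, key]
    exact hA

/-! ### The check of the doubling -/

theorem passes_skipGap {n : ℕ} (hn : 0 < n) (m : Bool) (c : ℤ) (u : List (Fin 2)) :
    Passes (skipGap m) c (List.replicate n 0 ++ 1 :: u) ↔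
      Passes (if m then pass else upGap false) c u := by
  rw [passes_replicate_succ (s' := skipRun m) (d := 0) (fun _ => rfl) (fun _ => rfl) hn,
    passes_cons_of_step (s' := if m then pass else upGap false) (d := 0)
      (fun _ => by cases m <;> rfl)]
  simp

theorem passes_upGap {n : ℕ} (hn : 0 < n) (m : Bool) (c : ℤ) (u : List (Fin 2)) :
    Passes (upGap m) c (List.replicate n 0 ++ 1 :: u) ↔
      Passes (if m then pass else downGap false) (c + n) u := by
  rw [passes_replicate_succ (s' := upRun m) (d := 1) (fun _ => rfl) (fun _ => rfl) hn,
    passes_cons_of_step (s' := if m then pass else downGap false) (d := 0)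
      (fun _ => by cases m <;> rfl)]
  simp

theorem passes_downEven (m : Bool) (n : ℕ) (c : ℤ) (u : List (Fin 2)) :
    Passes (downEven m) c (List.replicate n 0 ++ 1 :: u) ↔
      (n : ℤ) = 2 * c ∧ Passes (if m then pass else upGap false) 0 u := by
  induction n using Nat.strong_induction_on generalizing c with
  | _ n ih =>
    match n with
    | 0 =>
      rw [List.replicate_zero, List.nil_append, passes_cons]
      by_cases hc : c = 0
      · subst hc
        cases m <;> simp [step]
      · simp [step, hc, not_passes_fail]
    | 1 =>
      have h : ¬ (1 : ℤ) = 2 * c := by omega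
      simp only [Nat.cast_one, h, false_and, iff_false]
      exact not_passes_fail _ _
    | n + 2 =>
      rw [List.replicate_succ, List.replicate_succ, List.cons_append, List.cons_append,
        passes_cons_of_step (s' := downOdd m) (d := 0) (fun _ => rfl),
        passes_cons_of_step (s' := downEven m) (d := -1) (fun _ => rfl), ih n (by omega)]
      refine and_congr_left fun _ => ?_
      simp
      omega

theorem passes_downGap {n : ℕ} (hn : 0 < n) (m : Bool) (c : ℤ) (u : List (Fin 2)) :
    Passes (downGap m) c (List.replicate n 0 ++ 1 :: u) ↔
      (n : ℤ) = 2 * c ∧ Passes (if m then pass else upGap false) 0 u := by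
  -- `downGap` and `downEven` act alike on a zero; they differ only on a one.
  obtain ⟨n, rfl⟩ := Nat.exists_eq_succ_of_ne_zero hn.ne'
  rw [← passes_downEven]
  rfl

/-- Each successful comparison leaves the counter at zero, ready for the next pair. The cases are
the positions of the marker: before the first block of a pair, inside a pair, or later. -/
theorem passes_upGap_shapedWord {A : List ℕ} {n b : ℕ} {D : List ℕ} (hA : ∀ x ∈ A, 0 < x)
    (hn : 0 < n) : Passes (upGap false) 0 (shapedWord A n b D) ↔
      (A ++ [n]).PairsRelated (fun x y => y = 2 * x) := by
  match A with
  | [] =>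
    rw [shapedWord, zeroBlocks_nil, List.nil_append,
      passes_cons_of_step (s' := upGap true) (d := 0) (fun _ => rfl), passes_upGap hn]
    simp [List.PairsRelated, passes_pass]
  | [x] =>
    rw [shapedWord, zeroBlocks_cons, List.append_assoc, List.cons_append,
      passes_upGap (hA x (by simp)), zeroBlocks_nil, List.nil_append]
    simp only [Bool.false_eq_true, if_false]
    rw [passes_cons_of_step (s' := downGap true) (d := 0) (fun _ => rfl), passes_downGap hn]
    simp only [if_true, passes_pass, List.PairsRelated, List.cons_append, List.nil_append]
    simp
    omega
  | x :: y :: A =>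
    have ih := passes_upGap_shapedWord (A := A) (b := b) (D := D)
      (fun z hz => hA z (by simp [hz])) hn
    rw [shapedWord, zeroBlocks_cons, List.append_assoc, List.cons_append,
      passes_upGap (hA x (by simp)), zeroBlocks_cons, List.append_assoc, List.cons_append]
    simp only [Bool.false_eq_true, if_false]
    rw [passes_downGap (hA y (by simp))]
    simp only [Bool.false_eq_true, if_false]
    rw [← shapedWord, ih]
    simp only [List.cons_append, List.PairsRelated]
    refine and_congr_left fun _ => ?_
    omega

theorem passes_skipGap_shapedWord {A : List ℕ} {n b : ℕ} {D : List ℕ} (hA : ∀ x ∈ A, 0 < x)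
    (hn : 0 < n) : Passes (skipGap false) 0 (shapedWord A n b D) ↔
      (A ++ [n]).tail.PairsRelated (fun x y => y = 2 * x) := by
  match A with
  | [] =>
    rw [shapedWord, zeroBlocks_nil, List.nil_append,
      passes_cons_of_step (s' := skipGap true) (d := 0) (fun _ => rfl), passes_skipGap hn]
    simp [List.PairsRelated, passes_pass]
  | x :: A =>
    have ih := passes_upGap_shapedWord (A := A) (b := b) (D := D)
      (fun z hz => hA z (by simp [hz])) hn
    rw [shapedWord, zeroBlocks_cons, List.append_assoc, List.cons_append,
      passes_skipGap (hA x (by simp))]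
    simpa [shapedWord] using ih

/-! ### The late checks -/

theorem passes_lateGap {A : List ℕ} (hA : ∀ x ∈ A, 0 < x) (t : LateCheck) (c : ℤ)
    (u : List (Fin 2)) :
    Passes (lateGap t) c (zeroBlocks A ++ 1 :: u) ↔ Passes (lateLong t) c u := by
  induction A with
  | nil =>
    rw [zeroBlocks_nil, List.nil_append,
      passes_cons_of_step (s' := lateLong t) (d := 0) (fun _ => rfl)]
    simp
  | cons x A ih =>
    rw [zeroBlocks_cons, List.append_assoc,
      passes_replicate_succ (s' := lateRun t) (d := 0) (fun _ => rfl) (fun _ => rfl)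
        (hA x (by simp)), List.cons_append,
      passes_cons_of_step (s' := lateGap t) (d := 0) (fun _ => rfl)]
    simpa using ih (fun y hy => hA y (by simp [hy]))

theorem passes_lateGap_shapedWord {A : List ℕ} (hA : ∀ x ∈ A, 0 < x) (t : LateCheck) (n b : ℕ)
    (D : List ℕ) : Passes (lateGap t) 0 (shapedWord A n b D) ↔
      Passes (lateOnes t) (if t = .half then n else 0) (List.replicate b 1 ++ zeroBlocks D) := by
  rw [shapedWord, passes_lateGap hA,
    passes_replicate (d := if t = .half then 1 else 0) (fun _ => rfl),
    passes_cons_of_step (s' := lateOnes t) (d := 0) (fun _ => rfl)]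
  split_ifs <;> simp

theorem zeroBlocks_cons_of_pos {x : ℕ} (hx : 0 < x) (D : List ℕ) :
    zeroBlocks (x :: D) = 0 :: (List.replicate (x - 1) 0 ++ 1 :: zeroBlocks D) := by
  obtain ⟨x, rfl⟩ := Nat.exists_eq_succ_of_ne_zero hx.ne'
  simp [List.replicate_succ]

theorem passes_lateOnes_half (b : ℕ) (c : ℤ) (u : List (Fin 2)) :
    Passes (lateOnes .half) c (List.replicate b 1 ++ 0 :: u) ↔ (b : ℤ) = 2 * c := by
  induction b using Nat.strong_induction_on generalizing c with
  | _ n ih =>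
    match n with
    | 0 =>
      rw [List.replicate_zero, List.nil_append, passes_cons]
      by_cases hc : c = 0
      · simp [step, hc, passes_pass]
      · simp [step, hc, not_passes_fail]
    | 1 =>
      have h : ¬ (1 : ℤ) = 2 * c := by omega
      simp only [Nat.cast_one, h, iff_false]
      exact not_passes_fail _ _
    | n + 2 =>
      rw [List.replicate_succ, List.replicate_succ, List.cons_append, List.cons_append,
        passes_cons_of_step (s' := lateOnesOdd) (d := 0) (fun _ => rfl),
        passes_cons_of_step (s' := lateOnes .half) (d := -1) (fun _ => rfl), ih n (by omega)]
      simp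
      omega

theorem passes_tailTotal (c : ℤ) (u : List (Fin 2)) :
    Passes tailTotal c u ↔ c = u.length := by
  induction u generalizing c with
  | nil => simp [Passes, verdict]
  | cons a u ih =>
    rw [passes_cons_of_step (s' := tailTotal) (d := -1) (fun _ => rfl), ih]
    simp
    omega

theorem passes_lateOnes_total (b : ℕ) {D : List ℕ} (hD : D ≠ []) (hD' : ∀ x ∈ D, 0 < x) :
    Passes (lateOnes .total) 0 (List.replicate b 1 ++ zeroBlocks D) ↔
      b = (zeroBlocks D).length := by
  match D with
  | x :: D =>
    rw [passes_replicate (d := 1) (fun _ => rfl), zeroBlocks_cons_of_pos (hD' x (by simp)),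
      passes_cons_of_step (s' := tailTotal) (d := -1) (fun _ => rfl), passes_tailTotal]
    simp
    omega

theorem passes_tailCount (c : ℤ) (D : List ℕ) :
    Passes tailCount c (zeroBlocks D) ↔ c = D.length := by
  induction D generalizing c with
  | nil => simp [Passes, verdict]
  | cons x D ih =>
    rw [zeroBlocks_cons, passes_replicate (d := 0) (fun _ => rfl),
      passes_cons_of_step (s' := tailCount) (d := -1) (fun _ => rfl), ih]
    simp
    omega

/-- The one closing the first tail block is not subtracted, so its zeros are matched with the later
blocks. -/
theorem passes_lateOnes_count (b : ℕ) {x : ℕ} (hx : 0 < x) (D : List ℕ) :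
    Passes (lateOnes .count) 0 (List.replicate b 1 ++ zeroBlocks (x :: D)) ↔ x = D.length := by
  rw [passes_replicate (d := 0) (fun _ => rfl), zeroBlocks_cons,
    passes_replicate_succ (s' := tailFirst) (d := 1) (fun _ => rfl) (fun _ => rfl) hx,
    passes_cons_of_step (s' := tailCount) (d := 0) (fun _ => rfl), passes_tailCount]
  simp

theorem passes_tailUp (D : List ℕ) :
    Passes tailUp 0 (zeroBlocks D) ↔ D.PairsRelated Eq := by
  match D with
  | [] => simp [Passes, verdict, List.PairsRelated]
  -- An unpaired last block is left uncompared: `tailDown` has a neutral verdict whatever the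
  -- counter.
  | [x] =>
    rw [zeroBlocks_cons, passes_replicate (d := 1) (fun _ => rfl),
      passes_cons_of_step (s' := tailDown) (d := 0) (fun _ => rfl)]
    simp [Passes, verdict, List.PairsRelated]
  | x :: y :: D =>
    have ih := passes_tailUp D
    rw [zeroBlocks_cons, passes_replicate (d := 1) (fun _ => rfl),
      passes_cons_of_step (s' := tailDown) (d := 0) (fun _ => rfl), zeroBlocks_cons,
      passes_replicate (d := -1) (fun _ => rfl), passes_cons]
    by_cases h : x = y
    · simpa [step, h, List.PairsRelated] using ih
    · have h' : ¬ (x : ℤ) + -y = 0 := by omega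
      simp [step, h, h', List.PairsRelated, not_passes_fail]

theorem passes_lateOnes_equal_false (b : ℕ) {D : List ℕ} (hD : D ≠ []) (hD' : ∀ x ∈ D, 0 < x) :
    Passes (lateOnes (.equal false)) 0 (List.replicate b 1 ++ zeroBlocks D) ↔
      D.PairsRelated Eq := by
  match D with
  | x :: D =>
    rw [← passes_tailUp, passes_replicate (d := 0) (fun _ => rfl),
      zeroBlocks_cons_of_pos (hD' x (by simp))]
    simp only [SignType.coe_zero, mul_zero, add_zero]
    rfl

theorem passes_lateOnes_equal_true (b : ℕ) {D : List ℕ} (hD : D ≠ []) (hD' : ∀ x ∈ D, 0 < x) :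
    Passes (lateOnes (.equal true)) 0 (List.replicate b 1 ++ zeroBlocks D) ↔
      D.tail.PairsRelated Eq := by
  match D with
  | x :: D =>
    rw [passes_replicate (d := 0) (fun _ => rfl), zeroBlocks_cons,
      passes_replicate_succ (s' := tailSkip) (d := 0) (fun _ => rfl) (fun _ => rfl)
        (hD' x (by simp)), passes_cons_of_step (s' := tailUp) (d := 0) (fun _ => rfl)]
    simpa using passes_tailUp D

end Control

/-! ### From length equations to membership -/

theorem List.eq_map_range_of_isChain_two_mul (x : ℕ) (l : List ℕ)
    (h : (x :: l).IsChain (fun x y => y = 2 * x)) :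
    x :: l = (List.range (l.length + 1)).map (fun i => x * 2 ^ i) := by
  induction l generalizing x with
  | nil => simp
  | cons y l ih =>
    rw [List.isChain_cons_cons] at h
    obtain ⟨rfl, h⟩ := h
    conv_lhs => rw [ih _ h]
    rw [List.length_cons, List.range_succ_eq_map (n := l.length + 1), List.map_cons, List.map_map,
      pow_zero, mul_one]
    congr 1
    refine List.map_congr_left fun i _ => ?_
    simp only [Function.comp_apply, Nat.succ_eq_add_one]
    ring

theorem length_zeroBlocks_replicate (m x : ℕ) :
    (zeroBlocks (List.replicate m x)).length = m * (x + 1) := by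
  induction m with
  | zero => simp
  | succ m ih =>
    rw [List.replicate_succ, zeroBlocks_cons]
    simp only [List.length_append, List.length_replicate, List.length_cons, ih]
    ring

namespace Control

/-- The starting states of the checks. -/
def checkStart : Fin 8 → Control :=
  ![shapeStart, upGap false, skipGap false, lateGap .half, lateGap .total, lateGap .count,
    lateGap (.equal false), lateGap (.equal true)]

theorem not_isCoin_checkStart (i : Fin 8) : ¬ (checkStart i).IsCoin := by
  fin_cases i <;> exact id

/-- The checks that come after the check of the shape, as equations between the lengths of the
blocks. -/
theorem forall_passes_shapedWord_iff {A : List ℕ} {n b x : ℕ} {D : List ℕ}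
    (hs : IsShape A n (x :: D)) :
    (∀ i, i ≠ 0 → Passes (checkStart i) 0 (shapedWord A n b (x :: D))) ↔
      (A ++ [n]).IsChain (fun x y => y = 2 * x) ∧ b = 2 * n ∧
        b = (zeroBlocks (x :: D)).length ∧ x = D.length ∧ (x :: D).IsChain Eq := by
  have hx := hs.3 x (by simp)
  have h3 : Passes (lateGap .half) 0 (shapedWord A n b (x :: D)) ↔ b = 2 * n := by
    rw [passes_lateGap_shapedWord hs.1, if_pos rfl, zeroBlocks_cons_of_pos hx,
      passes_lateOnes_half]
    omega
  have h4 : Passes (lateGap .total) 0 (shapedWord A n b (x :: D)) ↔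
      b = (zeroBlocks (x :: D)).length := by
    rw [passes_lateGap_shapedWord hs.1, if_neg (by simp), passes_lateOnes_total b hs.4 hs.3]
  have h5 : Passes (lateGap .count) 0 (shapedWord A n b (x :: D)) ↔ x = D.length := by
    rw [passes_lateGap_shapedWord hs.1, if_neg (by simp), passes_lateOnes_count b hx]
  have h6 : Passes (lateGap (.equal false)) 0 (shapedWord A n b (x :: D)) ↔
      (x :: D).PairsRelated Eq := by
    rw [passes_lateGap_shapedWord hs.1, if_neg (by simp), passes_lateOnes_equal_false b hs.4 hs.3]
  have h7 : Passes (lateGap (.equal true)) 0 (shapedWord A n b (x :: D)) ↔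
      (x :: D).tail.PairsRelated Eq := by
    rw [passes_lateGap_shapedWord hs.1, if_neg (by simp), passes_lateOnes_equal_true b hs.4 hs.3]
  rw [← List.pairsRelated_and_tail, ← List.pairsRelated_and_tail, ← h3, ← h4, ← h5, ← h6, ← h7,
    ← passes_upGap_shapedWord (b := b) (D := x :: D) hs.1 hs.2,
    ← passes_skipGap_shapedWord (b := b) (D := x :: D) hs.1 hs.2]
  simp [Fin.forall_fin_succ, checkStart]
  tauto

theorem isShape_dima3Word (k : ℕ) (hk : 0 < k) :
    IsShape ((List.range (6 * k - 1)).map (2 ^ ·)) (2 ^ (6 * k - 1))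
      (List.replicate (2 ^ (3 * k)) (2 ^ (3 * k) - 1)) := by
  have h8 : 1 < 2 ^ (3 * k) := Nat.one_lt_two_pow (by omega)
  refine ⟨by simp, by positivity, fun x hx => ?_, by simp⟩
  rw [List.eq_of_mem_replicate hx]
  omega

/-- The checks find no error exactly in the members of `DIMA3`. -/
theorem forall_passes_iff (u : List (Fin 2)) : (∀ i, Passes (checkStart i) 0 u) ↔ u ∈ DIMA3 := by
  constructor
  · intro h
    obtain ⟨A, n, b, D, hs, hA, rfl⟩ := (passes_shapeStart_iff u 0).1 (h 0)
    obtain ⟨x, D, rfl⟩ := List.exists_cons_of_ne_nil hs.4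
    obtain ⟨h1, hb, h2, h3, h4⟩ := (forall_passes_shapedWord_iff hs).1 fun i _ => h i
    obtain ⟨j, hj⟩ : ∃ j, A.length = 6 * j + 4 := ⟨A.length / 6, by omega⟩
    have h1 := List.eq_map_range_of_isChain_two_mul 1 (A ++ [n]) h1
    have e : (A ++ [n]).length + 1 = (6 * j + 5) + 1 := by simp [hj]
    rw [e, List.range_succ, List.map_append, ← List.cons_append] at h1
    obtain ⟨hA', hn⟩ := List.append_inj' h1 rfl
    have hn : n = 2 ^ (6 * j + 5) := by simpa using hn
    have hD : x :: D = List.replicate (x + 1) x := by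
      rw [List.eq_replicate_iff]
      refine ⟨by simp [h3], ?_⟩
      rw [List.isChain_iff_pairwise, List.pairwise_cons] at h4
      intro y hy
      rcases List.mem_cons.1 hy with rfl | hy
      · rfl
      · exact (h4.1 y hy).symm
    rw [hD, length_zeroBlocks_replicate, hb, hn] at h2
    -- The tail is a square, `x + 1` blocks of length `x + 1`, and its total length is 2 to the
    -- power `6 * (j + 1)`.
    have hx : x + 1 = 2 ^ (3 * (j + 1)) := by
      refine Nat.mul_self_inj.1 (h2.symm.trans ?_)
      ring
    refine ⟨j + 1, by omega, ?_⟩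
    rw [dima3Word_eq_shapedWord, hD, hA', hb, hn, ← hx, Nat.add_sub_cancel,
      show 6 * (j + 1) - 1 = 6 * j + 5 by omega]
    simp only [one_mul]
    congr 1
    ring
  · rintro ⟨k, hk, rfl⟩ i
    have hs := isShape_dima3Word k hk
    obtain ⟨j, rfl⟩ : ∃ j, k = j + 1 := ⟨k - 1, by omega⟩
    have e : 6 * (j + 1) - 1 = 6 * j + 5 := by omega
    rw [dima3Word_eq_shapedWord]
    by_cases hi : i = 0
    · subst hi
      refine (passes_shapeStart_iff _ 0).2
        ⟨(List.range (6 * j + 4)).map (2 ^ Nat.succ ·), 2 ^ (6 * (j + 1) - 1), 2 ^ (6 * (j + 1)),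
          List.replicate (2 ^ (3 * (j + 1))) (2 ^ (3 * (j + 1)) - 1), ?_, by simp, ?_⟩
      swap
      · rw [e, List.range_succ_eq_map]
        simp only [List.map_cons, List.map_map, pow_zero]
        rfl
      · rw [e, List.range_succ_eq_map] at hs
        simp only [List.map_cons, List.map_map, pow_zero] at hs
        exact hs
    · obtain ⟨x, hx⟩ : ∃ x, 2 ^ (3 * (j + 1)) = x + 1 :=
        Nat.exists_eq_succ_of_ne_zero (by positivity)
      rw [hx, Nat.add_sub_cancel, List.replicate_succ] at hs ⊢
      refine (forall_passes_shapedWord_iff hs).2 ⟨?_, ?_, ?_, by simp, ?_⟩ i hi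
      · have : (List.range (6 * (j + 1) - 1)).map (2 ^ ·) ++ [2 ^ (6 * (j + 1) - 1)] =
            (List.range (6 * (j + 1) - 1 + 1)).map (2 ^ ·) := by
          rw [List.range_succ, List.map_append]
          rfl
        rw [this, List.isChain_iff_getElem]
        intro i hi
        simp [pow_succ']
      · rw [← pow_succ']
        rfl
      · rw [← List.replicate_succ, length_zeroBlocks_replicate, ← hx]
        ring
      · rw [List.isChain_iff_pairwise, ← List.replicate_succ, List.pairwise_replicate]
        simp

/-! ### The branch with the coin -/

theorem prob_cons_of_step {s s' : Control} {a : Fin 2} {d : SignType} {c : ℤ}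
    (h : ∀ t, s.step a (decide (c = 0)) t = (s', d)) (p : ℝ) (v : Option Bool)
    (u : List (Fin 2)) : prob p v (a :: u) s c = prob p v u s' (c + d) := by
  simp only [prob, h]
  ring

theorem prob_replicate {s : Control} {a : Fin 2} (h : ∀ z t, s.step a z t = (s, 0)) (p : ℝ)
    (v : Option Bool) (n : ℕ) (c : ℤ) (u : List (Fin 2)) :
    prob p v (List.replicate n a ++ u) s c = prob p v u s c := by
  induction n with
  | zero => simp
  | succ n ih =>
    rw [List.replicate_succ, List.cons_append, prob_cons_of_step (h _)]
    simpa using ih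

theorem prob_coinGap_zeroBlocks {A : List ℕ} (hA : ∀ x ∈ A, 0 < x) (p : ℝ) (v : Option Bool)
    (c : ℤ) (u : List (Fin 2)) :
    prob p v (zeroBlocks A ++ u) coinGap c = prob p v u coinGap c := by
  induction A with
  | nil => simp
  | cons x A ih =>
    obtain ⟨m, rfl⟩ := Nat.exists_eq_succ_of_ne_zero (hA x (by simp)).ne'
    rw [zeroBlocks_cons, List.append_assoc, List.replicate_succ, List.cons_append,
      prob_cons_of_step (s' := coinRun) (d := 0) (fun _ => rfl),
      prob_replicate (fun _ _ => rfl), List.cons_append,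
      prob_cons_of_step (s' := coinGap) (d := 0) (fun _ => rfl)]
    simpa using ih (fun y hy => hA y (by simp [hy]))

theorem prob_coinDone (p : ℝ) (v w : Bool) (u : List (Fin 2)) (c : ℤ) :
    prob p (some v) u (coinDone w) c = if w = v then 1 else 0 := by
  induction u generalizing c with
  | nil => simp [prob, verdict]
  | cons a u ih => rw [prob_cons_of_step (s' := coinDone w) (d := 0) (fun _ => rfl), ih]

/-- In a block of the tail, either the counter is found to be zero, or it decreases by the length of
the block. -/
theorem prob_coinTail_run (p : ℝ) (v : Bool) (j : Fin 8) (n c : ℕ) (u : List (Fin 2)) :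
    prob p (some v) (List.replicate n 0 ++ 1 :: u) (coinTail j) c =
      if c ≤ n then (if decide (4 ≤ j) = v then 1 else 0)
      else prob p (some v) u (coinTail (j + 1)) ((c - (n + 1) : ℕ) : ℤ) := by
  induction n generalizing c with
  | zero =>
    rcases c with _ | c
    · rw [List.replicate_zero, List.nil_append,
        prob_cons_of_step (s' := coinDone (4 ≤ j)) (d := 0) (fun _ => by simp [step]),
        prob_coinDone]
      simp
    · have h : ¬ ((c + 1 : ℕ) : ℤ) = 0 := by omega
      rw [List.replicate_zero, List.nil_append,
        prob_cons_of_step (s' := coinTail (j + 1)) (d := -1) (fun _ => by simp [step]; omega)]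
      simp
  | succ n ih =>
    rw [List.replicate_succ, List.cons_append]
    rcases c with _ | c
    · rw [prob_cons_of_step (s' := coinDone (4 ≤ j)) (d := 0) (fun _ => by simp [step]),
        prob_coinDone]
      simp
    · rw [prob_cons_of_step (s' := coinTail j) (d := -1) (fun _ => by simp [step]; omega)]
      have e : ((c + 1 : ℕ) : ℤ) + ((-1 : SignType) : ℤ) = c := by simp
      rw [e, ih]
      simp [Nat.add_sub_add_right]

/-- Each completed block subtracts its length from the counter and adds one to the state, which is
division with the quotient kept modulo 8. The bound on `c` ensures that zero is reached, at the
end-marker at the latest. -/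
theorem prob_coinTail (p : ℝ) (v : Bool) (j m x c : ℕ) (hc : c ≤ m * (x + 1)) :
    prob p (some v) (zeroBlocks (List.replicate m x)) (coinTail (Fin.ofNat 8 j)) c =
      if decide (4 ≤ (j + c / (x + 1)) % 8) = v then 1 else 0 := by
  induction m generalizing j c with
  | zero =>
    obtain rfl : c = 0 := by omega
    have e : (4 ≤ Fin.ofNat 8 j) ↔ 4 ≤ j % 8 := Iff.rfl
    simp only [List.replicate_zero, zeroBlocks_nil, prob, Nat.cast_zero, decide_true, verdict,
      if_true, Option.some.injEq, e, Nat.zero_div, add_zero]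
  | succ m ih =>
    rw [List.replicate_succ, zeroBlocks_cons, prob_coinTail_run]
    by_cases h : c ≤ x
    · have e : (4 ≤ Fin.ofNat 8 j) ↔ 4 ≤ j % 8 := Iff.rfl
      rw [if_pos h]
      simp only [Nat.div_eq_of_lt (show c < x + 1 by omega), add_zero, e]
    · have e : Fin.ofNat 8 j + 1 = Fin.ofNat 8 (j + 1) := by
        simp only [Fin.ext_iff, Fin.val_add, Fin.val_ofNat, Fin.isValue]
        omega
      rw [if_neg h, e, ih _ _ (by rw [Nat.succ_mul] at hc; omega)]
      have h' : c / (x + 1) = (c - (x + 1)) / (x + 1) + 1 := by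
        rw [← Nat.add_div_right _ (by omega), Nat.sub_add_cancel (by omega)]
      rw [h', show j + ((c - (x + 1)) / (x + 1) + 1) = j + 1 + (c - (x + 1)) / (x + 1) by omega]

/-- Every one is a toss and every head increments the counter: the same recursion as `tossMean`. -/
theorem prob_coinToss (p : ℝ) (v : Option Bool) (u : List (Fin 2)) (n c : ℕ) :
    prob p v (List.replicate n 1 ++ u) coinToss c =
      tossMean p (fun c => prob p v u coinToss c) n c := by
  induction n generalizing c with
  | zero => rfl
  | succ n ih =>
    have h1 := ih (c + 1)
    push_cast at h1
    simp only [List.replicate_succ, List.cons_append, prob, tossMean, ← ih c, ← h1]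
    simp [step]

theorem tossMean_congr {p : ℝ} {F G : ℕ → ℝ} {M : ℕ} (h : ∀ c ≤ M, F c = G c) (n c : ℕ)
    (hc : c + n ≤ M) : tossMean p F n c = tossMean p G n c := by
  induction n generalizing c with
  | zero => exact h c (by omega)
  | succ n ih => rw [tossMean, tossMean, ih _ (by omega), ih _ (by omega)]

open Classical in
theorem prob_coinGap_dima3Word_ge (I : Set ℕ+) (k : ℕ+) :
    3 / 4 ≤ prob (coinProb I) (some (decide (k ∈ I))) (dima3Word k) coinGap 0 := by
  set v := decide (k ∈ I) with hv
  set p := coinProb I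
  have hs := isShape_dima3Word k k.pos
  have h8 : (8 : ℕ) ^ (k : ℕ) = 2 ^ (3 * (k : ℕ)) := by rw [pow_mul]; norm_num
  have h64 : (2 : ℕ) ^ (6 * (k : ℕ)) = 64 ^ (k : ℕ) := by rw [pow_mul]; norm_num
  obtain ⟨x, hx⟩ : ∃ x, 2 ^ (3 * (k : ℕ)) = x + 1 :=
    Nat.exists_eq_succ_of_ne_zero (by positivity)
  have hxx : 64 ^ (k : ℕ) = (x + 1) * (x + 1) := by
    rw [← hx, ← h64]; ring
  have hmain := tossMean_coinProb_ge I k v hv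
  rw [dima3Word_eq_shapedWord, shapedWord, prob_coinGap_zeroBlocks hs.1,
    prob_cons_of_step (s' := coinLong) (d := 0) (fun _ => rfl),
    prob_replicate (fun _ _ => rfl), prob_cons_of_step (s' := coinToss) (d := 0) (fun _ => rfl),
    h64]
  have h0 := prob_coinToss p (some v) (zeroBlocks (List.replicate (2 ^ (3 * (k : ℕ)))
    (2 ^ (3 * (k : ℕ)) - 1))) (64 ^ (k : ℕ)) 0
  simp only [SignType.coe_zero, add_zero, Nat.cast_zero] at h0 ⊢
  rw [h0]
  refine hmain.trans (le_of_eq (tossMean_congr (M := 64 ^ (k : ℕ)) (fun c hc => ?_) _ _ (by simp)))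
  have hpos : 0 < x := by
    have : 1 < 2 ^ (3 * (k : ℕ)) := Nat.one_lt_two_pow (by have := k.pos; omega)
    omega
  rw [h8, hx, Nat.add_sub_cancel]
  have ht := prob_coinTail p v 0 (x + 1) x c (by omega)
  rw [zero_add] at ht
  rw [← ht, List.replicate_succ, zeroBlocks_cons_of_pos hpos]
  -- On the first zero of the tail, `coinToss` behaves like `coinTail 0`, also when the counter is
  -- empty.
  by_cases hc0 : c = 0
  · subst hc0
    rw [prob_cons_of_step (s' := coinDone false) (d := 0) (fun _ => rfl),
      prob_cons_of_step (s' := coinDone false) (d := 0) (fun _ => rfl)]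
  · have h : ¬ (c : ℤ) = 0 := by omega
    rw [prob_cons_of_step (s' := coinTail 0) (d := -1) (fun _ => by simp [step, hc0]),
      prob_cons_of_step (s' := coinTail 0) (d := -1) (fun _ => by simp [step, hc0])]

end Control

/-! ### The automaton -/

/-- The branch that is entered from the left end-marker: the branch with the coin, or a check. -/
abbrev Branch : Type := Option (Fin 8)

namespace Branch

/-- The starting state of a branch. -/
def start : Branch → Control
  | none => .coinGap
  | some i => Control.checkStart i

/-- The probability with which a branch is chosen. -/
def weight : Branch → ℚ
  | none => 1 / 17
  | some _ => 2 / 17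

theorem weight_nonneg (b : Branch) : 0 ≤ b.weight := by
  cases b <;> norm_num [weight]

theorem sum_weight : ∑ b : Branch, ((b.weight : ℚ) : ℝ) = 1 := by
  rw [Fintype.sum_option]
  norm_num [weight]

end Branch

/-- The states: the start (`none`), the states of the control, and, after the right end-marker, the
verdicts. -/
abbrev CoinState : Type := Option (Control ⊕ Option Bool)

/-- The next state, and the change of the counter, when the left end-marker has been read. -/
def coinStep (s : Control ⊕ Option Bool) (σ : TapeSymbol (Fin 2)) (z h : Bool) :
    CoinState × SignType :=
  match s, σ with
  | .inl s, .sym a => (some (.inl (s.step a z h).1), (s.step a z h).2)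
  | .inl s, .dollar => (some (.inr (s.verdict z)), 0)
  -- A filler, like the next case: between its end-markers an input has no further end-marker.
  | .inl s, .cent => (some (.inl s), 0)
  | .inr v, _ => (some (.inr v), 0)

/-- The transition probabilities, where `p` is the head probability of the coin. -/
noncomputable def coinTransition (p : ℝ) (s : CoinState) (σ : TapeSymbol (Fin 2)) (z : Bool)
    (s' : CoinState) (d : SignType) : ℝ :=
  match s with
  | none => ∑ b : Branch, if (some (.inl b.start), 0) = (s', d) then (b.weight : ℝ) else 0
  | some s => (if coinStep s σ z true = (s', d) then p else 0) +
      (if coinStep s σ z false = (s', d) then 1 - p else 0)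

theorem sum_ite_eq_pair {S : Type} [Fintype S] [DecidableEq S] (t : S × SignType) (p : ℝ)
    (f : S → SignType → ℝ) :
    ∑ s', ∑ d, (if t = (s', d) then p else 0) * f s' d = p * f t.1 t.2 := by
  rw [← Fintype.sum_prod_type' (f := fun s' d => (if t = (s', d) then p else 0) * f s' d)]
  rw [Finset.sum_eq_single t]
  · simp
  · intro b _ hb
    rw [if_neg (fun h => hb (by rw [h])), zero_mul]
  · simp

theorem sum_coinTransition_none (p : ℝ) (σ : TapeSymbol (Fin 2)) (z : Bool)
    (f : CoinState → SignType → ℝ) :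
    ∑ s', ∑ d, coinTransition p none σ z s' d * f s' d =
      ∑ b : Branch, (b.weight : ℝ) * f (some (.inl b.start)) 0 := by
  simp only [coinTransition, Finset.sum_mul]
  rw [Finset.sum_congr rfl fun _ _ => Finset.sum_comm, Finset.sum_comm]
  exact Finset.sum_congr rfl fun b _ => sum_ite_eq_pair _ _ _

theorem sum_coinTransition_some (p : ℝ) (s : Control ⊕ Option Bool) (σ : TapeSymbol (Fin 2))
    (z : Bool) (f : CoinState → SignType → ℝ) :
    ∑ s', ∑ d, coinTransition p (some s) σ z s' d * f s' d =
      p * f (coinStep s σ z true).1 (coinStep s σ z true).2 +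
        (1 - p) * f (coinStep s σ z false).1 (coinStep s σ z false).2 := by
  simp only [coinTransition, add_mul, Finset.sum_add_distrib]
  rw [sum_ite_eq_pair, sum_ite_eq_pair]

/-- The automaton with a coin of head probability `p`. -/
noncomputable def coinAutomaton (p : ℝ) (hp0 : 0 ≤ p) (hp1 : p ≤ 1) : PostPCA (Fin 2) where
  State := CoinState
  δ := coinTransition p
  start := none
  accept := some (.inr (some true))
  reject := some (.inr (some false))
  accept_ne_reject := by decide
  δ_nonneg s σ z s' d := by
    have := sub_nonneg.2 hp1
    cases s with
    | none =>
      refine Finset.sum_nonneg fun b _ => ?_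
      have := b.weight_nonneg
      split_ifs
      · exact_mod_cast this
      · exact le_rfl
    | some s =>
      refine add_nonneg ?_ ?_ <;> split_ifs <;> first | assumption | exact le_rfl
  δ_sum s σ z := by
    cases s with
    | none =>
      have h := sum_coinTransition_none p σ z fun _ _ => 1
      simp only [mul_one] at h
      rw [h, Branch.sum_weight]
    | some s =>
      have h := sum_coinTransition_some p s σ z fun _ _ => 1
      simp only [mul_one] at h
      rw [h]
      ring

theorem coinTransition_rational_or_coin (p : ℝ) (s : CoinState) (σ : TapeSymbol (Fin 2)) (z : Bool)
    (s' : CoinState) (d : SignType) :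
    (∃ q : ℚ, coinTransition p s σ z s' d = (q : ℝ)) ∨ coinTransition p s σ z s' d = p ∨
      coinTransition p s σ z s' d = 1 - p := by
  cases s with
  | none =>
    refine Or.inl ⟨∑ b : Branch, if (some (.inl b.start), 0) = (s', d) then b.weight else 0, ?_⟩
    rw [coinTransition, Rat.cast_sum]
    refine Finset.sum_congr rfl fun b _ => ?_
    split_ifs <;> simp
  | some s =>
    simp only [coinTransition]
    -- If both outcomes of the toss give the same move, its probability is `p + (1 - p) = 1`.
    split_ifs
    · exact Or.inl ⟨1, by simp⟩
    · exact Or.inr (Or.inl (by simp))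
    · exact Or.inr (Or.inr (by simp))
    · exact Or.inl ⟨0, by simp⟩

/-! ### Weights of acceptance and rejection -/

section

variable {p : ℝ} (hp0 : 0 ≤ p) (hp1 : p ≤ 1)

/-- Each transition has at most two outcomes, weighted `p` and `1 - p`, as in the recursion of
`Control.prob`; the right end-marker stores the verdict in the state. -/
theorem endProb_coinAutomaton_control (v : Option Bool) (w : List (Fin 2)) (s : Control) (c : ℤ) :
    (coinAutomaton p hp0 hp1).endProb (some (.inr v)) (w.map TapeSymbol.sym ++ [TapeSymbol.dollar])
      (some (.inl s)) c = s.prob p v w c := by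
  induction w generalizing s c with
  | nil =>
    refine (sum_coinTransition_some p (.inl s) .dollar (decide (c = 0)) fun s' d =>
      (coinAutomaton p hp0 hp1).endProb (some (.inr v)) [] s' (c + (d : ℤ))).trans ?_
    have h (c' : ℤ) : (coinAutomaton p hp0 hp1).endProb (some (.inr v)) []
        (some (.inr (s.verdict (decide (c = 0))))) c' = s.prob p v [] c := by
      by_cases hv : s.verdict (decide (c = 0)) = v
      · exact (if_pos (by rw [hv])).trans (if_pos hv).symm
      · exact (if_neg fun e => hv (Sum.inr.inj (Option.some.inj e))).trans (if_neg hv).symm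
    simp only [coinStep, h]
    ring
  | cons a w ih =>
    refine (sum_coinTransition_some p (.inl s) (.sym a) (decide (c = 0)) fun s' d =>
      (coinAutomaton p hp0 hp1).endProb (some (.inr v))
        (w.map TapeSymbol.sym ++ [TapeSymbol.dollar]) s' (c + (d : ℤ))).trans ?_
    simp only [coinStep, Control.prob, ih]

theorem endProb_coinAutomaton (v : Option Bool) (w : List (Fin 2)) :
    (coinAutomaton p hp0 hp1).endProb (some (.inr v)) (markedInput w) none 0 =
      1 / 17 * Control.prob p v w .coinGap 0 +
        ∑ i, 2 / 17 * Control.prob p v w (Control.checkStart i) 0 := by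
  refine (sum_coinTransition_none p .cent true fun s' d =>
    (coinAutomaton p hp0 hp1).endProb (some (.inr v))
      (w.map TapeSymbol.sym ++ [TapeSymbol.dollar]) s' (0 + (d : ℤ))).trans ?_
  rw [Fintype.sum_option]
  simp only [endProb_coinAutomaton_control, Branch.start, Branch.weight, SignType.coe_zero,
    add_zero]
  norm_num

theorem acceptWeight_coinAutomaton (w : List (Fin 2)) :
    (coinAutomaton p hp0 hp1).acceptWeight w = 1 / 17 * Control.prob p (some true) w .coinGap 0 := by
  refine (endProb_coinAutomaton hp0 hp1 (some true) w).trans ?_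
  rw [Finset.sum_eq_zero, add_zero]
  intro i _
  rw [Control.prob_true_of_not_isCoin p w (Control.not_isCoin_checkStart i), mul_zero]

theorem rejectWeight_coinAutomaton_of_mem {w : List (Fin 2)} (hw : w ∈ DIMA3) :
    (coinAutomaton p hp0 hp1).rejectWeight w =
      1 / 17 * Control.prob p (some false) w .coinGap 0 := by
  refine (endProb_coinAutomaton hp0 hp1 (some false) w).trans ?_
  rw [Finset.sum_eq_zero, add_zero]
  intro i _
  rw [Control.prob_false_of_passes p w (Control.not_isCoin_checkStart i) 0
    ((Control.forall_passes_iff w).2 hw i), mul_zero]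

theorem rejectWeight_coinAutomaton_of_not_mem {w : List (Fin 2)} (hw : w ∉ DIMA3) :
    2 / 17 + 1 / 17 * Control.prob p (some false) w .coinGap 0 ≤
      (coinAutomaton p hp0 hp1).rejectWeight w := by
  refine le_trans ?_ (endProb_coinAutomaton hp0 hp1 (some false) w).ge
  obtain ⟨i, hi⟩ := not_forall.1 fun h => hw ((Control.forall_passes_iff w).1 h)
  have h := Finset.single_le_sum (f := fun i => 2 / 17 *
    Control.prob p (some false) w (Control.checkStart i) 0) (fun j _ => mul_nonneg (by norm_num)
      (Control.prob_nonneg hp0 hp1 (some false) w (Control.checkStart j) 0)) (Finset.mem_univ i)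
  simp only [Control.prob_false_of_not_passes p w (Control.not_isCoin_checkStart i) 0 hi] at h
  linarith

end

theorem coinAutomaton_recognizes (I : Set ℕ+) :
    (coinAutomaton (coinProb I) (Real.ofDigits_nonneg _) (Real.ofDigits_le_one _)).Recognizes
      (DIMA3On I) (2 / 5) := by
  classical
  intro w
  set p := coinProb I
  have hp0 : 0 ≤ p := Real.ofDigits_nonneg _
  have hp1 : p ≤ 1 := Real.ofDigits_le_one _
  have hadd := Control.prob_add_prob_of_isCoin p w (s := .coinGap) trivial 0
  have h1 := Control.prob_nonneg hp0 hp1 (some true) w .coinGap 0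
  have h0 := Control.prob_nonneg hp0 hp1 (some false) w .coinGap 0
  rw [acceptWeight_coinAutomaton hp0 hp1]
  by_cases hw : w ∈ DIMA3
  · rw [rejectWeight_coinAutomaton_of_mem hp0 hp1 hw, ← mul_add, hadd]
    refine ⟨by norm_num, fun hI => ?_, fun hI => ?_⟩
    · obtain ⟨-, k, hk, rfl⟩ := hI
      have h := Control.prob_coinGap_dima3Word_ge I k
      rw [decide_eq_true hk] at h
      -- The branch probability 1/17 cancels, leaving the success probability of the coin branch, at
      -- least 3/4.
      rw [mul_div_mul_left _ _ (by norm_num), div_one]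
      linarith
    · obtain ⟨k, hk, rfl⟩ := hw
      have h := Control.prob_coinGap_dima3Word_ge I ⟨k, hk⟩
      rw [decide_eq_false (fun h => hI ((dima3Word_mem_dima3On I ⟨k, hk⟩).2 h))] at h
      simp only [PNat.mk_coe] at h
      rw [mul_div_mul_left _ _ (by norm_num), div_one]
      linarith
  · have h := rejectWeight_coinAutomaton_of_not_mem hp0 hp1 hw
    refine ⟨by linarith, fun hI => absurd hI.1 hw, fun _ => ?_⟩
    -- One failing check outweighs the coin branch two to one, giving even 2/3 here.
    rw [le_div_iff₀ (by linarith)]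
    linarith

theorem mainTheorem2 :
    (¬ {L : Language (Fin 2) | ∃ P : PostPCA (Fin 2),
        P.IsLinearSpace ∧ P.Recognizes L (2 / 5)}.Countable) ∧
    ∀ I : Set ℕ+, ∃ P : PostPCA (Fin 2),
      (∀ s σ z s' d, (∃ q : ℚ, P.δ s σ z s' d = (q : ℝ)) ∨
        P.δ s σ z s' d = coinProb I ∨ P.δ s σ z s' d = 1 - coinProb I) ∧
      P.IsLinearSpace ∧ P.Recognizes (DIMA3On I) (2 / 5) :=
  ⟨not_countable_of_range_DIMA3On_subset fun I =>
      ⟨_, PostPCA.isLinearSpace _, coinAutomaton_recognizes I⟩,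
    fun I => ⟨_, coinTransition_rational_or_coin _, PostPCA.isLinearSpace _,
      coinAutomaton_recognizes I⟩⟩
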